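/- Let $K$ be an infinite field and let $H(K)=\mathrm{UT}_3(K)$ be its Heisenberg group, i.e. the group of $3\times 3$ upper unitriangular matrices over $K$. Then the group $H(K)$ (as a structure in the language of groups) is not bi-interpretable with the field $K$ (as a structure in the language of rings), even when arbitrary parameters $A\subseteq K$ and $B\subseteq H(K)$ are allowed. Here an interpretation of a structure $N$ in a structure $M$ with parameters from $A\subseteq M$ is an $A$-definable set $D\subseteq M^n$ (for some $n$) together with a surjection $f\colon D\to N$ such that the preimages under $f$ of the equality relation, of the graphs of the basic functions and of the basic relations of $N$ are $A$-definable in $M$. The structures $M$ and $N$ are bi-interpretable with parameters from $A\subseteq M$ and $B\subseteq N$ if there are an interpretation $f\colon D\to N$ of $N$ in $M$ with parameters from $A$, with $D\subseteq M^n$, and an interpretation $g\colon E\to M$ of $M$ in $N$ with parameters from $B$, with $E\subseteq N^m$, such that the partial map $f\circ g^{\times n}$ from $N^{nm}$ to $N$ is definable in $N$ over $B$, and the partial map $g\circ f^{\times m}$ from $M^{mn}$ to $M$ is definable in $M$ over $A$. -/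

import Mathlib

universe u v u' v' w w'

namespace FirstOrder

/-- The function symbols of the language of groups: multiplication, inverse, and identity. -/
inductive groupFunc : ℕ → Type
  | mul : groupFunc 2
  | inv : groupFunc 1
  | one : groupFunc 0

/-- The first-order language of groups, with function symbols `*`, `⁻¹`, `1` and no relation
symbols. -/
def Language.group : Language.{0, 0} :=
  { Functions := groupFunc
    Relations := fun _ => Empty }

/-- Every group is a structure for the language of groups. -/
instance groupStructure (G : Type*) [Group G] : Language.group.Structure G where
  funMap := fun {_} f =>
    match f with
    | .mul => fun x => x 0 * x 1
    | .inv => fun x => (x 0)⁻¹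
    | .one => fun _ => 1
  RelMap := fun r => r.elim

namespace Language

/-- Let `f : D → N` be a map defined on a set `D` of `n`-tuples of elements of `M`, and let `S`
be a set of tuples of elements of `N`. This is the set of tuples of `n`-tuples in `D` which are
sent into `S` by `f` applied entrywise. -/
def coordPreimage {M : Type w} {N : Type w'} {n : ℕ} {D : Set (Fin n → M)} (f : D → N)
    {ι : Type*} (S : Set (ι → N)) : Set (ι × Fin n → M) :=
  {v | ∃ h : ∀ i, (fun j => v (i, j)) ∈ D, (fun i => f ⟨fun j => v (i, j), h i⟩) ∈ S}

/-- A (finite-dimensional) interpretation of the `L'`-structure `N` in the `L`-structure `M`,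
with parameters from `A ⊆ M`: a definable set of `dim`-tuples together with a surjection onto
`N` (the coordinate map), such that the preimages of equality on `N`, of the graphs of the
basic functions of `N`, and of the basic relations of `N` are all definable. Since the coordinate
map need not be injective, `N` is a definable quotient of the domain. -/
structure Interpretation (L : Language.{u, v}) {M : Type w} [L.Structure M] (A : Set M)
    (L' : Language.{u', v'}) (N : Type w') [L'.Structure N] where
  /-- The dimension. -/
  dim : ℕ
  /-- The domain. -/
  domain : Set (Fin dim → M)
  /-- The coordinate map. -/
  coord : domain → N
  coord_surjective : Function.Surjective coord
  definable_domain : A.Definable L domain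
  definable_eq : A.Definable L (coordPreimage coord {x : Fin 2 → N | x 0 = x 1})
  definable_fun : ∀ {n : ℕ} (f : L'.Functions n), A.Definable L
    (coordPreimage coord
      {x : Fin (n + 1) → N | Structure.funMap f (fun i : Fin n => x i.castSucc) = x (Fin.last n)})
  definable_rel : ∀ {n : ℕ} (r : L'.Relations n), A.Definable L
    (coordPreimage coord {x : Fin n → N | Structure.RelMap r x})

namespace Interpretation

variable {L : Language.{u, v}} {M : Type w} [L.Structure M] {A : Set M}
  {L' : Language.{u', v'}} {N : Type w'} [L'.Structure N] {B : Set N}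

/-- The graph of the coordinate map of the composition of an interpretation `Γ` of `N` in `M` with
an interpretation `Δ` of `M` in `N`. It consists of all `(t, y)`, where `y ∈ N` and `t` is a tuple
(of length `Γ.dim`) of tuples in the domain of `Δ`, such that applying the coordinate map of `Δ`
entrywise to `t` yields a tuple in the domain of `Γ` that the coordinate map of `Γ` sends to
`y`. -/
def compGraph (Γ : Interpretation L A L' N) (Δ : Interpretation L' B L M) :
    Set ((Fin Γ.dim × Fin Δ.dim) ⊕ Unit → N) :=
  {v | ∃ (h : ∀ i, (fun j => v (Sum.inl (i, j))) ∈ Δ.domain)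
      (h' : (fun i => Δ.coord ⟨fun j => v (Sum.inl (i, j)), h i⟩) ∈ Γ.domain),
      Γ.coord ⟨fun i => Δ.coord ⟨fun j => v (Sum.inl (i, j)), h i⟩, h'⟩ = v (Sum.inr ())}

end Interpretation

/-- The `L`-structure `M` and the `L'`-structure `N` are bi-interpretable with parameters from
`A ⊆ M` and `B ⊆ N`: there are interpretations of each of them in the other such that both
compositions are homotopic to the identity interpretation, that is, the graphs of the coordinate
maps of both compositions (of `N` in itself, and of `M` in itself) are definable. -/
def BiInterpretable (L : Language.{u, v}) {M : Type w} [L.Structure M] (A : Set M)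
    (L' : Language.{u', v'}) {N : Type w'} [L'.Structure N] (B : Set N) : Prop :=
  ∃ (Γ : Interpretation L A L' N) (Δ : Interpretation L' B L M),
    B.Definable L' (Γ.compGraph Δ) ∧ A.Definable L (Δ.compGraph Γ)

end Language

end FirstOrder

/-- The Heisenberg group `H(K) = UT₃(K)`: the group of upper unitriangular `3` by `3` matrices
over `K`. -/
def heisenbergGroup (K : Type u) [Field K] : Subgroup (GL (Fin 3) K) where
  carrier := {g | ∃ a b c : K, (g : Matrix (Fin 3) (Fin 3) K) = !![1, a, c; 0, 1, b; 0, 0, 1]}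
  mul_mem' := by
    rintro g h ⟨a, b, c, hg⟩ ⟨a', b', c', hh⟩
    refine ⟨a + a', b + b', c + a * b' + c', ?_⟩
    rw [Units.val_mul, hg, hh]
    ext i j
    fin_cases i <;> fin_cases j <;> simp [Matrix.mul_apply, Fin.sum_univ_three] <;> ring
  one_mem' := by
    refine ⟨0, 0, 0, ?_⟩
    ext i j
    fin_cases i <;> fin_cases j <;> simp
  inv_mem' := by
    rintro g ⟨a, b, c, hg⟩
    refine ⟨-a, -b, -c + a * b, ?_⟩
    refine Units.inv_eq_of_mul_eq_one_right ?_
    rw [hg]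
    ext i j
    fin_cases i <;> fin_cases j <;> simp [Matrix.mul_apply, Fin.sum_univ_three]

/-! Already the composite of the interpretations that returns to the group cannot be definable. Pass
to ultrapowers `F` of `K` and `H` of the group; `F` is uncountable. Every additive `φ : F → F` gives
a central automorphism `x ↦ x * emb (φ (proj x))` of `H`; if `φ` kills the projections of the
finitely many parameters, it preserves the definable sets (`map_mem_starSet`) and induces through
`Δ` a map of `F` respecting sums and products. Let `v` range over prime-field combinations of `Δ.dim
+ 1` independent functionals. These are countably many, and the functionals can be chosen so that
all induced maps fix a common uncountable set (`exists_functionals`). Then one element `w` codes any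
finite set (`exists_forall_eq_of_eq`), in particular `Γ`-codes of group elements that detect every
coordinate of `v`. Definability of the composite shows that only `v = 0` fixes `w`. But fixing the
`Δ.dim` entries of a code of `w` is only `Δ.dim` linear conditions on `v`, a contradiction. -/

open FirstOrder Filter

/-! ### Ultrapowers: extensions of sets and maps, uncountability. -/

namespace Filter.Germ

section Star

variable {I : Type*} (u : Ultrafilter I) {M N ι : Type*}

/-- The extension of a set of tuples to the ultrapower. -/
def starSet (S : Set (ι → M)) : Set (ι → Germ (u : Filter I) M) :=
  {x | ∃ y : ι → I → M, (x = fun a => (y a : Germ (u : Filter I) M)) ∧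
    ∀ᶠ i in u, (fun a => y a i) ∈ S}

theorem exists_rep (x : ι → Germ (u : Filter I) M) :
    ∃ y : ι → I → M, x = fun a => (y a : Germ (u : Filter I) M) := by
  choose y hy using fun a => Quotient.exists_rep (x a)
  exact ⟨y, funext fun a => (hy a).symm⟩

variable {u}

/-- Finitely many almost-everywhere equalities hold simultaneously almost everywhere, so sets and
maps extend independently of representatives. -/
theorem eventually_eq_of_coe_eq [Finite ι] {y z : ι → I → M}
    (h : (fun a => (y a : Germ (u : Filter I) M)) = fun a => (z a : Germ (u : Filter I) M)) :
    ∀ᶠ i in u, (fun a => y a i) = fun a => z a i := by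
  have h1 : ∀ a, ∀ᶠ i in (u : Filter I), y a i = z a i := fun a => coe_eq.1 (congrFun h a)
  filter_upwards [eventually_all.2 h1] with i hi
  exact funext hi

theorem mem_starSet_coe [Finite ι] {S : Set (ι → M)} (y : ι → I → M) :
    (fun a => (y a : Germ (u : Filter I) M)) ∈ starSet u S ↔
      ∀ᶠ i in u, (fun a => y a i) ∈ S := by
  constructor
  · rintro ⟨z, hz, h⟩
    filter_upwards [h, eventually_eq_of_coe_eq hz] with i hi hi'
    rwa [hi']
  · exact fun h => ⟨y, rfl, h⟩

variable (u) in
/-- The extension of a function of several variables to the ultrapower. -/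
noncomputable def starMap (f : (ι → M) → N) (x : ι → Germ (u : Filter I) M) :
    Germ (u : Filter I) N :=
  ((fun i => f fun a => (exists_rep u x).choose a i : I → N) : Germ (u : Filter I) N)

theorem starMap_coe [Finite ι] (f : (ι → M) → N) (y : ι → I → M) :
    starMap u f (fun a => (y a : Germ (u : Filter I) M)) =
      ((fun i => f fun a => y a i : I → N) : Germ (u : Filter I) N) := by
  refine coe_eq.2 ?_
  filter_upwards [eventually_eq_of_coe_eq
    (exists_rep u fun a => (y a : Germ (u : Filter I) M)).choose_spec] with i hi
  rw [← hi]

end Star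

/-- An ultrapower of an infinite type along a free ultrafilter on `ℕ` is uncountable. -/
theorem uncountable_hyperfilter (M : Type*) [Infinite M] :
    Uncountable (Germ (hyperfilter ℕ : Filter ℕ) M) := by
  rw [← not_countable_iff]
  intro _
  obtain ⟨e, he⟩ := exists_surjective_nat (Germ (hyperfilter ℕ : Filter ℕ) M)
  choose y hy using fun n => Quotient.exists_rep (e n)
  -- Diagonalization: `z` differs from the `n`-th germ at every index `i ≥ n`.
  have hz : ∀ i : ℕ, ∃ z : M, ∀ n ≤ i, z ≠ y n i := by
    intro i
    obtain ⟨z, hz⟩ := ((Set.finite_Iic i).image fun n => y n i).infinite_compl.nonempty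
    exact ⟨z, fun n hn h => hz ⟨n, hn, h.symm⟩⟩
  choose z hz using hz
  obtain ⟨n, hn⟩ := he (z : Germ (hyperfilter ℕ : Filter ℕ) M)
  have h1 : (y n : Germ (hyperfilter ℕ : Filter ℕ) M) = z := (hy n).trans hn
  have h2 : ∀ᶠ i in (hyperfilter ℕ : Filter ℕ), n ≤ i :=
    Nat.hyperfilter_le_atTop (eventually_ge_atTop n)
  obtain ⟨i, hi, hi'⟩ := ((coe_eq.1 h1).and h2).exists
  exact hz i n hi' hi.symm

end Filter.Germ

/-! ### Łoś's theorem for groups and automorphisms of ultrapowers. -/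

namespace FirstOrder.Language

open Filter.Germ

variable {I : Type*} {u : Ultrafilter I} {G : Type*} [Group G]

/-- An isomorphism of groups is an isomorphism of structures for the language of groups. -/
def groupEquiv {H H' : Type*} [Group H] [Group H'] (σ : H ≃* H') : H ≃[Language.group] H' where
  toEquiv := σ.toEquiv
  map_fun' := by
    intro n f x
    cases f
    · exact map_mul σ (x 0) (x 1)
    · exact map_inv σ (x 0)
    · exact map_one σ
  map_rel' := fun r => r.elim

/-- The ultrapower of a group as a structure is its ultrapower as a group. -/
def germEquiv : Germ (u : Filter I) G ≃[Language.group] (u : Filter I).Product fun _ => G where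
  toEquiv := _root_.Equiv.refl (Germ (u : Filter I) G)
  map_fun' := by
    intro n f x
    obtain ⟨y, rfl⟩ := exists_rep u x
    refine Eq.trans ?_ (Ultraproduct.funMap_cast (M := fun _ => G) f y).symm
    cases f <;> rfl
  map_rel' := fun r => r.elim

theorem realize_germ {β : Type*} (φ : Language.group.Formula β) (y : β → I → G) :
    (φ.Realize fun b => (y b : Germ (u : Filter I) G)) ↔ ∀ᶠ i in u, φ.Realize fun b => y b i :=
  (StrongHomClass.realize_formula (germEquiv (u := u) (G := G)) φ).symm.trans
    (Ultraproduct.realize_formula_cast (M := fun _ => G) φ y)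

/-- Automorphisms of the ultrapower of a group which fix the parameters preserve the extensions
of definable sets. -/
theorem map_mem_starSet {ι : Type*} [Finite ι] {B : Set G} {S : Set (ι → G)}
    (hS : B.Definable Language.group S) (σ : Germ (u : Filter I) G ≃* Germ (u : Filter I) G)
    (hσ : ∀ b ∈ B, σ (b : Germ (u : Filter I) G) = (b : Germ (u : Filter I) G))
    {x : ι → Germ (u : Filter I) G} (hx : x ∈ starSet u S) :
    (fun a => σ (x a)) ∈ starSet u S := by
  obtain ⟨φ, rfl⟩ := Set.definable_iff_exists_formula_sum.1 hS
  -- Łoś's theorem, with the parameters viewed as constant germs.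
  have key : ∀ y : ι → I → G, (fun a => (y a : Germ (u : Filter I) G)) ∈
      starSet u {v | φ.Realize (Sum.elim (↑) v)} ↔
      φ.Realize (Sum.elim (fun b : B => ((b : G) : Germ (u : Filter I) G))
        fun a => (y a : Germ (u : Filter I) G)) := by
    intro y
    rw [mem_starSet_coe]
    have := realize_germ (u := u) φ (Sum.elim (fun (b : B) (_ : I) => (b : G)) y)
    convert this.symm using 1
    · refine eventually_congr (Eventually.of_forall fun i => ?_)
      refine iff_of_eq (congrArg φ.Realize (funext fun b => ?_))
      cases b <;> rfl
    · refine iff_of_eq (congrArg φ.Realize (funext fun b => ?_))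
      cases b <;> rfl
  obtain ⟨y, rfl⟩ := exists_rep u x
  obtain ⟨z, hz⟩ := exists_rep u fun a => σ (y a : Germ (u : Filter I) G)
  rw [hz, key, ← hz]
  rw [key, ← StrongHomClass.realize_formula (groupEquiv σ)] at hx
  convert hx using 1
  funext b
  rcases b with b | a
  · exact (hσ b b.2).symm
  · rfl

end FirstOrder.Language

/-! ### Central automorphisms. -/

/-- A group `G` with a surjective homomorphism onto the additive group of `K` and an embedding of
the additive group of `K` into the kernel of this homomorphism, with central image. -/
structure CentralPair (K G : Type*) [AddCommGroup K] [Group G] where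
  /-- The homomorphism onto `K`. -/
  proj : G → K
  /-- The central embedding of `K`. -/
  emb : K → G
  proj_mul : ∀ x y, proj (x * y) = proj x + proj y
  emb_add : ∀ c d, emb (c + d) = emb c * emb d
  emb_comm : ∀ c x, emb c * x = x * emb c
  proj_emb : ∀ c, proj (emb c) = 0
  proj_surjective : Function.Surjective proj
  emb_injective : Function.Injective emb

namespace CentralPair

section Shift

variable {K G : Type*} [AddCommGroup K] [Group G] (P : CentralPair K G)

theorem emb_zero : P.emb 0 = 1 := by
  have h := P.emb_add 0 0
  rw [add_zero] at h
  exact left_eq_mul.1 h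

theorem proj_shift (φ : K →+ K) (x : G) : P.proj (x * P.emb (φ (P.proj x))) = P.proj x := by
  rw [P.proj_mul, P.proj_emb, add_zero]

/-- The central automorphism given by an additive endomorphism of `K`. -/
def shift (φ : K →+ K) : G ≃* G where
  toFun x := x * P.emb (φ (P.proj x))
  invFun x := x * P.emb (-φ (P.proj x))
  left_inv x := by
    simp only [P.proj_shift]
    rw [mul_assoc, ← P.emb_add, add_neg_cancel, P.emb_zero, mul_one]
  right_inv x := by
    have h : P.proj (x * P.emb (-φ (P.proj x))) = P.proj x := by
      rw [P.proj_mul, P.proj_emb, add_zero]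
    beta_reduce
    rw [h, mul_assoc, ← P.emb_add, neg_add_cancel, P.emb_zero, mul_one]
  map_mul' x y := by
    rw [P.proj_mul, map_add, P.emb_add, mul_assoc, mul_assoc, ← mul_assoc y, ← P.emb_comm _ y]
    simp only [mul_assoc]

theorem shift_apply (φ : K →+ K) (x : G) : P.shift φ x = x * P.emb (φ (P.proj x)) := rfl

theorem shift_eq_self_iff (φ : K →+ K) (x : G) : P.shift φ x = x ↔ φ (P.proj x) = 0 := by
  rw [shift_apply, mul_eq_left, ← P.emb_zero, P.emb_injective.eq_iff]

end Shift

section Germ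

variable {I K G : Type*} [Field K] [Group G] (P : CentralPair K G) (u : Ultrafilter I)

/-- The ultrapower of a central pair. -/
def germ : CentralPair (Germ (u : Filter I) K) (Germ (u : Filter I) G) where
  proj := Germ.map P.proj
  emb := Germ.map P.emb
  proj_mul x y := Germ.inductionOn₂ x y fun f g =>
    Germ.coe_eq.2 (Eventually.of_forall fun i => P.proj_mul (f i) (g i))
  emb_add x y := Germ.inductionOn₂ x y fun f g =>
    Germ.coe_eq.2 (Eventually.of_forall fun i => P.emb_add (f i) (g i))
  emb_comm x y := Germ.inductionOn₂ x y fun f g =>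
    Germ.coe_eq.2 (Eventually.of_forall fun i => P.emb_comm (f i) (g i))
  proj_emb x := Germ.inductionOn x fun f =>
    Germ.coe_eq.2 (Eventually.of_forall fun i => P.proj_emb (f i))
  proj_surjective x := Germ.inductionOn x fun f => by
    choose g hg using fun i => P.proj_surjective (f i)
    exact ⟨(g : Germ (u : Filter I) G), Germ.coe_eq.2 (Eventually.of_forall hg)⟩
  emb_injective x y := Germ.inductionOn₂ x y fun f g h =>
    Germ.coe_eq.2 ((Germ.coe_eq.1 h).mono fun _ hi => P.emb_injective hi)

end Germ

end CentralPair

/-! ### The Heisenberg group as an instance. -/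

/-- The element of the Heisenberg group with the given entries above the diagonal. -/
def heisenbergGroup.mk {K : Type*} [Field K] (a b c : K) : heisenbergGroup K :=
  ⟨Matrix.GeneralLinearGroup.mkOfDetNeZero !![1, a, c; 0, 1, b; 0, 0, 1]
    (by simp [Matrix.det_fin_three]), a, b, c, rfl⟩

theorem heisenbergGroup.ext {K : Type*} [Field K] {g h : heisenbergGroup K}
    (H : ∀ i j, (g : GL (Fin 3) K) i j = (h : GL (Fin 3) K) i j) : g = h :=
  Subtype.ext (Units.ext (Matrix.ext H))

/-- The Heisenberg group with its first coordinate and its center. -/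
def heisenbergGroup.centralPair (K : Type*) [Field K] : CentralPair K (heisenbergGroup K) where
  proj g := (g : GL (Fin 3) K) 0 1
  emb c := mk 0 0 c
  proj_mul := by
    rintro ⟨g, a, b, c, hg⟩ ⟨h, a', b', c', hh⟩
    simp [Matrix.mul_apply, Fin.sum_univ_three, hg, hh, add_comm]
  emb_add c d := by
    refine heisenbergGroup.ext fun i j => ?_
    fin_cases i <;> fin_cases j <;>
      simp [mk, Matrix.GeneralLinearGroup.mkOfDetNeZero, Matrix.mul_apply, Fin.sum_univ_three,
        add_comm]
  emb_comm := by
    rintro d ⟨g, a, b, c, hg⟩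
    refine heisenbergGroup.ext fun i j => ?_
    fin_cases i <;> fin_cases j <;>
      simp [mk, Matrix.GeneralLinearGroup.mkOfDetNeZero, Matrix.mul_apply, Fin.sum_univ_three,
        hg, add_comm]
  proj_emb c := by simp [mk, Matrix.GeneralLinearGroup.mkOfDetNeZero]
  proj_surjective a := ⟨mk a 0 0, by simp [mk, Matrix.GeneralLinearGroup.mkOfDetNeZero]⟩
  emb_injective c d h := by
    have := congrArg (fun g : heisenbergGroup K => (g : GL (Fin 3) K) 0 2) h
    simpa [mk, Matrix.GeneralLinearGroup.mkOfDetNeZero] using this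

/-! ### Coding finite sets and choosing functionals. -/

/-- If countably many additive and multiplicative self-maps of a field fix uncountably many
elements in common, then any finite set of elements can be replaced by a single element, as far as
the maps fixing it are concerned. -/
theorem exists_forall_eq_of_eq {F V : Type*} [Field F] [Countable V] (τ : V → F → F)
    (hadd : ∀ v x y, τ v (x + y) = τ v x + τ v y) (hmul : ∀ v x y, τ v (x * y) = τ v x * τ v y)
    {C : Set F} (hC : ¬ C.Countable) (hfix : ∀ v, ∀ c ∈ C, τ v c = c) (s : Finset F) :
    ∃ w, ∀ v, τ v w = w → ∀ x ∈ s, τ v x = x := by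
  classical
  induction s using Finset.induction_on with
  | empty => exact ⟨0, by simp⟩
  | insert x s _ ih =>
    obtain ⟨w, hw⟩ := ih
    -- If `τ v` moves `x` but fixes `w + c * x`, then `c` equals this quotient: each `v` excludes
    -- one `c`. When `τ v x = x` the quotient is a harmless default.
    obtain ⟨c, hc, hcv⟩ : ∃ c ∈ C, c ∉ Set.range fun v => -(τ v w - w) / (τ v x - x) := by
      by_contra! h
      exact hC ((Set.countable_range _).mono h)
    refine ⟨w + c * x, fun v hv => ?_⟩
    rw [hadd, hmul, hfix v c hc] at hv
    have hx : τ v x = x := by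
      by_contra hx
      refine hcv ⟨v, ?_⟩
      rw [div_eq_iff (sub_ne_zero.2 hx)]
      linear_combination -hv
    rw [hx, add_left_inj] at hv
    simpa [hx] using hw v hv

/-- In an uncountable vector space over a countable field, there are arbitrarily many independent
functionals vanishing on a given finite set and on uncountably many members of a given uncountable
family of finite sets. -/
theorem exists_functionals (k : Type*) {X W : Type*} [Field k] [Countable k] [AddCommGroup X]
    [Module k X] [Uncountable X] [Uncountable W] (Q : Finset X) (A : W → Finset X) (s : ℕ) :
    ∃ (C : Set W) (b : Fin s → X) (ψ : Fin s → X →ₗ[k] k), ¬ C.Countable ∧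
      (∀ i j, ψ i (b j) = if i = j then 1 else 0) ∧ (∀ i, ∀ q ∈ Q, ψ i q = 0) ∧
      ∀ i, ∀ w ∈ C, ∀ x ∈ A w, ψ i x = 0 := by
  classical
  let β := Module.Basis.ofVectorSpace k X
  have hinf : Infinite (Module.Basis.ofVectorSpaceIndex k X) := by
    by_contra h
    rw [not_infinite_iff_finite] at h
    have := β.equivFun.toEquiv.countable_iff.2 inferInstance
    exact not_countable_iff.2 ‹Uncountable X› this
  let e := Infinite.natEmbedding (Module.Basis.ofVectorSpaceIndex k X)
  let supp : X → Finset ℕ := fun x => (β.repr x).support.preimage e e.injective.injOn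
  have hsupp : ∀ x n, n ∉ supp x → β.coord (e n) x = 0 := by
    intro x n hn
    simpa [supp] using hn
  -- Pigeonhole: there are only countably many finite subsets of `ℕ`.
  obtain ⟨T, hT⟩ : ∃ T : Finset ℕ, ¬ {w | (A w).biUnion supp = T}.Countable := by
    by_contra! h
    refine Set.not_countable_univ (α := W) ((Set.countable_iUnion h).mono fun w _ => ?_)
    exact Set.mem_iUnion.2 ⟨_, rfl⟩
  -- Basis coordinates from `N` on vanish on `Q` and on every `A w` with support `T`.
  let N := (T ∪ Q.biUnion supp).sup id + 1
  have hN : ∀ n ∈ T ∪ Q.biUnion supp, ∀ j, N + j ≠ n := by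
    intro n hn j h
    have := Finset.le_sup (f := id) hn
    simp only [id] at this
    omega
  refine ⟨_, fun j => β (e (N + j)), fun j => β.coord (e (N + j)), hT, fun i j => ?_,
    fun i q hq => hsupp _ _ fun h => ?_, fun i w hw x hx => hsupp _ _ fun h => ?_⟩
  · simp [Module.Basis.coord_apply, Finsupp.single_apply, Fin.ext_iff, eq_comm]
  · exact hN _ (Finset.mem_union_right _ (Finset.mem_biUnion.2 ⟨q, hq, h⟩)) i rfl
  · refine hN _ (Finset.mem_union_left _ ?_) i rfl
    rw [← show (A w).biUnion supp = T from hw]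
    exact Finset.mem_biUnion.2 ⟨x, hx, h⟩

theorem Subfield.countable_bot (F : Type*) [Field F] : Countable (⊥ : Subfield F) := by
  rw [← Subfield.closure_empty, ← Cardinal.mk_le_aleph0_iff]
  exact (Subfield.cardinalMk_closure_le_max _).trans (by simp)

/-! ### Interpretations extended to ultrapowers. -/

namespace FirstOrder.Language.Interpretation

open Filter.Germ

section Total

variable {L : Language.{u, v}} {M : Type w} [L.Structure M] {A : Set M}
  {L' : Language.{u', v'}} {N : Type w'} [L'.Structure N]

open Classical in
/-- The coordinate map of an interpretation, extended by an arbitrary value. -/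
noncomputable def total [Nonempty N] (Δ : Interpretation L A L' N) (x : Fin Δ.dim → M) : N :=
  if h : x ∈ Δ.domain then Δ.coord ⟨x, h⟩ else Classical.arbitrary N

variable [Nonempty N] (Δ : Interpretation L A L' N)

theorem total_of_mem {x : Fin Δ.dim → M} (h : x ∈ Δ.domain) : Δ.total x = Δ.coord ⟨x, h⟩ :=
  dif_pos h

theorem mem_coordPreimage_iff {ι : Type*} {S : Set (ι → N)} {x : ι × Fin Δ.dim → M} :
    x ∈ coordPreimage Δ.coord S ↔ (∀ i, (fun j => x (i, j)) ∈ Δ.domain) ∧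
      (fun i => Δ.total fun j => x (i, j)) ∈ S := by
  constructor
  · rintro ⟨h, hS⟩
    refine ⟨h, ?_⟩
    convert hS using 2 with i
    exact Δ.total_of_mem (h i)
  · rintro ⟨h, hS⟩
    refine ⟨h, ?_⟩
    convert hS using 2 with i
    exact (Δ.total_of_mem (h i)).symm

variable {I : Type*} {u : Ultrafilter I}

theorem mem_starSet_coordPreimage_iff {ι : Type*} [Finite ι] {S : Set (ι → N)}
    {x : ι × Fin Δ.dim → Germ (u : Filter I) M} :
    x ∈ starSet u (coordPreimage Δ.coord S) ↔
      (∀ i, (fun j => x (i, j)) ∈ starSet u Δ.domain) ∧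
        (fun i => starMap u Δ.total fun j => x (i, j)) ∈ starSet u S := by
  obtain ⟨y, rfl⟩ := exists_rep u x
  simp only [starMap_coe, mem_starSet_coe, mem_coordPreimage_iff, eventually_and]
  rw [eventually_all]

theorem exists_mem_starSet_starMap_total_eq (z : Germ (u : Filter I) N) :
    ∃ x ∈ starSet u Δ.domain, starMap u Δ.total x = z := by
  refine Germ.inductionOn z fun f => ?_
  choose y hy using fun i => Δ.coord_surjective (f i)
  refine ⟨fun a => ((fun i => (y i : Fin Δ.dim → M) a : I → M) : Germ (u : Filter I) M),
    (mem_starSet_coe _).2 (Eventually.of_forall fun i => (y i).2), ?_⟩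
  rw [starMap_coe]
  exact coe_eq.2 (Eventually.of_forall fun i => (Δ.total_of_mem (y i).2).trans (hy i))

end Total

section Group

variable {G : Type*} [Group G] {B P : Set G} {L' : Language.{u', v'}} {N : Type w'}
  [L'.Structure N] [Nonempty N] (Δ : Interpretation Language.group B L' N)
  {I : Type*} {u : Ultrafilter I} {σ : Germ (u : Filter I) G ≃* Germ (u : Filter I) G}

/-- Applied to the graphs of the ring operations, this makes the map induced by `σ` additive and
multiplicative. -/
theorem map_mem_of_definable {n : ℕ} {S : Set (Fin n → N)}
    (hS : P.Definable Language.group (coordPreimage Δ.coord S))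
    (hσ : ∀ b ∈ P, σ (b : Germ (u : Filter I) G) = (b : Germ (u : Filter I) G))
    (e : Fin n → Fin Δ.dim → Germ (u : Filter I) G) (he : ∀ i, e i ∈ starSet u Δ.domain)
    (h : (fun i => starMap u Δ.total (e i)) ∈ starSet u S) :
    (∀ i, (fun j => σ (e i j)) ∈ starSet u Δ.domain) ∧
      (fun i => starMap u Δ.total fun j => σ (e i j)) ∈ starSet u S :=
  Δ.mem_starSet_coordPreimage_iff.1 <| map_mem_starSet hS σ hσ <|
    Δ.mem_starSet_coordPreimage_iff (x := fun p => e p.1 p.2).2 ⟨he, h⟩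

end Group

section Ring

variable {K G : Type*} [Field K] [Ring.CompatibleRing K] [Group G]

theorem mem_starSet_add_iff {I : Type*} {u : Ultrafilter I} {x : Fin 3 → Germ (u : Filter I) K} :
    x ∈ starSet u {x : Fin 3 → K | Structure.funMap Ring.addFunc
      (fun i : Fin 2 => x i.castSucc) = x (Fin.last 2)} ↔ x 0 + x 1 = x 2 := by
  obtain ⟨y, rfl⟩ := exists_rep u x
  simp only [mem_starSet_coe, Set.mem_ofPred_eq, Ring.CompatibleRing.funMap_add]
  exact coe_eq.symm

theorem mem_starSet_mul_iff {I : Type*} {u : Ultrafilter I} {x : Fin 3 → Germ (u : Filter I) K} :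
    x ∈ starSet u {x : Fin 3 → K | Structure.funMap Ring.mulFunc
      (fun i : Fin 2 => x i.castSucc) = x (Fin.last 2)} ↔ x 0 * x 1 = x 2 := by
  obtain ⟨y, rfl⟩ := exists_rep u x
  simp only [mem_starSet_coe, Set.mem_ofPred_eq, Ring.CompatibleRing.funMap_mul]
  exact coe_eq.symm

variable {A : Set K} {B : Set G} (Γ : Interpretation Language.ring A Language.group G)
  (Δ : Interpretation Language.group B Language.ring K)

/-- The extension of the graph of a composition of interpretations to the ultrapower. -/
theorem mem_starSet_compGraph_iff {I : Type*} {u : Ultrafilter I}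
    {x : (Fin Γ.dim × Fin Δ.dim) ⊕ Unit → Germ (u : Filter I) G} :
    x ∈ starSet u (Γ.compGraph Δ) ↔
      (∀ i, (fun j => x (Sum.inl (i, j))) ∈ starSet u Δ.domain) ∧
        (fun i => starMap u Δ.total fun j => x (Sum.inl (i, j))) ∈ starSet u Γ.domain ∧
        starMap u Γ.total (fun i => starMap u Δ.total fun j => x (Sum.inl (i, j))) =
          x (Sum.inr ()) := by
  have key : ∀ z : (Fin Γ.dim × Fin Δ.dim) ⊕ Unit → G, z ∈ Γ.compGraph Δ ↔
      (∀ i, (fun j => z (Sum.inl (i, j))) ∈ Δ.domain) ∧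
        (fun i => Δ.total fun j => z (Sum.inl (i, j))) ∈ Γ.domain ∧
        Γ.total (fun i => Δ.total fun j => z (Sum.inl (i, j))) = z (Sum.inr ()) := by
    intro z
    have aux : ∀ h : ∀ i, (fun j => z (Sum.inl (i, j))) ∈ Δ.domain,
        (fun i => Δ.coord ⟨fun j => z (Sum.inl (i, j)), h i⟩) =
          fun i => Δ.total fun j => z (Sum.inl (i, j)) :=
      fun h => funext fun i => (Δ.total_of_mem (h i)).symm
    constructor
    · rintro ⟨h, h', hz⟩
      rw [← Γ.total_of_mem] at hz
      rw [aux h] at h' hz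
      exact ⟨h, h', hz⟩
    · rintro ⟨h, h', hz⟩
      rw [← aux h] at h' hz
      rw [Γ.total_of_mem h'] at hz
      exact ⟨h, h', hz⟩
  obtain ⟨y, rfl⟩ := exists_rep u x
  simp only [starMap_coe, mem_starSet_coe, key, eventually_and]
  rw [eventually_all]
  exact and_congr Iff.rfl (and_congr Iff.rfl coe_eq.symm)

end Ring

end FirstOrder.Language.Interpretation

/-! ### The contradiction by counting dimensions. -/

namespace FirstOrder.Language

open Filter.Germ Interpretation

/-- A formula mentions only finitely many parameters. -/
theorem _root_.Set.Definable.exists_finset {L : Language} {M ι : Type*} [L.Structure M] {A : Set M}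
    {S : Set (ι → M)} (hS : A.Definable L S) : ∃ P : Finset M, (P : Set M).Definable L S :=
  let ⟨P, _, hP⟩ := Set.definable_iff_finitely_definable.1 hS
  ⟨P, hP⟩

/-- For an infinite field `K` and a group `G` with a central pair, an interpretation of `K` in `G`
composed with one of `G` in `K` is never definably isomorphic to the identity of `G`. -/
theorem not_definable_compGraph_of_centralPair {K G : Type*} [Field K] [Infinite K]
    [Ring.CompatibleRing K] [Group G] (P : CentralPair K G) {A : Set K} {B : Set G}
    (Γ : Interpretation Language.ring A Language.group G)
    (Δ : Interpretation Language.group B Language.ring K) :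
    ¬ B.Definable Language.group (Γ.compGraph Δ) := by
  classical
  intro hcomp
  obtain ⟨P₁, h₁⟩ := hcomp.exists_finset
  obtain ⟨P₂, h₂⟩ := (Δ.definable_fun Ring.addFunc).exists_finset
  obtain ⟨P₃, h₃⟩ := (Δ.definable_fun Ring.mulFunc).exists_finset
  let Q : Finset G := P₁ ∪ P₂ ∪ P₃
  replace h₁ : (Q : Set G).Definable Language.group _ := h₁.mono (by simp only [Q]; grind)
  replace h₂ : (Q : Set G).Definable Language.group _ := h₂.mono (by simp only [Q]; grind)
  replace h₃ : (Q : Set G).Definable Language.group _ := h₃.mono (by simp only [Q]; grind)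
  let u := hyperfilter ℕ
  let F := Germ (u : Filter ℕ) K
  let H := Germ (u : Filter ℕ) G
  have : Uncountable F := uncountable_hyperfilter K
  have : Countable (⊥ : Subfield F) := Subfield.countable_bot F
  let PH : CentralPair F H := P.germ u
  choose lift lift_mem lift_eq using Δ.exists_mem_starSet_starMap_total_eq (u := u)
  -- One functional more than the length of a `Δ`-code; the prime field makes the set of coefficient
  -- vectors countable.
  obtain ⟨C, b, ψ, hC, hψb, hψQ, hψC⟩ := exists_functionals (⊥ : Subfield F)
    (Q.image fun q : G => PH.proj (q : H))
    (fun w : F => Finset.univ.image fun j => PH.proj (lift w j)) (Δ.dim + 1)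
  let φ : (Fin (Δ.dim + 1) → (⊥ : Subfield F)) → F →+ F := fun v =>
    (algebraMap (⊥ : Subfield F) F).toAddMonoidHom.comp (∑ i, v i • ψ i).toAddMonoidHom
  have hφ : ∀ v x, φ v x = 0 ↔ ∑ i, v i * ψ i x = 0 := by
    intro v x
    rw [← map_eq_zero_iff (algebraMap (⊥ : Subfield F) F) (RingHom.injective _)]
    simp [φ]
  let σ : (Fin (Δ.dim + 1) → (⊥ : Subfield F)) → H ≃* H := fun v => PH.shift (φ v)
  have σ_eq : ∀ v x, σ v x = x ↔ ∑ i, v i * ψ i (PH.proj x) = 0 := fun v x =>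
    (PH.shift_eq_self_iff _ x).trans (hφ v _)
  have hσ : ∀ v, ∀ q ∈ (Q : Set G), σ v (q : H) = (q : H) := fun v q hq =>
    (σ_eq v _).2 <| Finset.sum_eq_zero fun i _ => by
      rw [hψQ i _ (Finset.mem_image_of_mem _ hq), mul_zero]
  -- Defined through the chosen codes `lift w`; independence of this choice is not needed.
  let τ : (Fin (Δ.dim + 1) → (⊥ : Subfield F)) → F → F := fun v w =>
    starMap u Δ.total fun j => σ v (lift w j)
  have τ_add : ∀ v x y, τ v (x + y) = τ v x + τ v y := fun v x y =>
    (mem_starSet_add_iff.1 (Δ.map_mem_of_definable h₂ (hσ v) ![lift x, lift y, lift (x + y)]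
      (by simp [Fin.forall_fin_succ, lift_mem])
      (mem_starSet_add_iff.2 (by simp [lift_eq]))).2).symm
  have τ_mul : ∀ v x y, τ v (x * y) = τ v x * τ v y := fun v x y =>
    (mem_starSet_mul_iff.1 (Δ.map_mem_of_definable h₃ (hσ v) ![lift x, lift y, lift (x * y)]
      (by simp [Fin.forall_fin_succ, lift_mem])
      (mem_starSet_mul_iff.2 (by simp [lift_eq]))).2).symm
  have τ_fix : ∀ v w, (∀ j, σ v (lift w j) = lift w j) → τ v w = w := by
    intro v w h
    simp only [τ, h, lift_eq]
  have τ_C : ∀ v, ∀ c ∈ C, τ v c = c := fun v c hc =>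
    τ_fix v c fun j => (σ_eq v _).2 <| Finset.sum_eq_zero fun i _ => by
      rw [hψC i c hc _ (Finset.mem_image_of_mem _ (Finset.mem_univ j)), mul_zero]
  choose h hh using fun i => PH.proj_surjective (b i)
  choose d d_mem d_eq using fun i => Γ.exists_mem_starSet_starMap_total_eq (u := u) (h i)
  obtain ⟨w, hw⟩ := exists_forall_eq_of_eq τ τ_add τ_mul hC τ_C
    (Finset.univ.image fun p : Fin (Δ.dim + 1) × Fin Γ.dim => d p.1 p.2)
  have faithful : ∀ v, τ v w = w → v = 0 := by
    intro v hv
    funext i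
    have hd : ∀ l, τ v (d i l) = d i l := fun l =>
      hw v hv _ (Finset.mem_image_of_mem _ (Finset.mem_univ (i, l)))
    -- `σ v` moves the graph point of `h i` to one over `σ v (h i)` whose codes still name the `d i
    -- l`; hence `σ v (h i) = h i`.
    have mem := (mem_starSet_compGraph_iff Γ Δ).1 <| map_mem_starSet h₁ (σ v) (hσ v) <|
      (mem_starSet_compGraph_iff Γ Δ
        (x := Sum.elim (fun p => lift (d i p.1) p.2) fun _ => h i)).2
      ⟨fun l => lift_mem (d i l), by simpa [lift_eq] using d_mem i, by simpa [lift_eq] using d_eq i⟩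
    have hfix : σ v (h i) = h i := by
      refine mem.2.2.symm.trans (Eq.trans (congrArg _ (funext fun l => ?_)) (d_eq i))
      exact hd l
    simpa [hh, hψb] using (σ_eq v _).1 hfix
  -- Row `j` says that `σ v` fixes the `j`-th entry of `lift w`; there are more unknowns than
  -- equations.
  let M : Matrix (Fin Δ.dim) (Fin (Δ.dim + 1)) (⊥ : Subfield F) :=
    Matrix.of fun j i => ψ i (PH.proj (lift w j))
  obtain ⟨v, hv, hv0⟩ := Submodule.exists_mem_ne_zero_of_ne_bot <|
    LinearMap.ker_ne_bot_of_finrank_lt (f := M.mulVecLin) (by simp)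
  refine hv0 (faithful v (τ_fix v w fun j => (σ_eq v _).2 ?_))
  have := congrFun (LinearMap.mem_ker.1 hv) j
  simpa [M, Matrix.mulVec, dotProduct, mul_comm] using this

end FirstOrder.Language

theorem mainTheorem4 (K : Type*) [Field K] [Infinite K] [FirstOrder.Ring.CompatibleRing K]
    (A : Set K) (B : Set (heisenbergGroup K)) :
    ¬ FirstOrder.Language.BiInterpretable FirstOrder.Language.ring A
      FirstOrder.Language.group B := by
  rintro ⟨Γ, Δ, h, -⟩
  exact FirstOrder.Language.not_definable_compGraph_of_centralPair
    (heisenbergGroup.centralPair K) Γ Δ h
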